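/- Let $K$ be a field, $n\ge 0$, and let $E=K\langle e_1,\dots,e_n\rangle$ be the exterior algebra of $K^n$ with its standard grading. Let $<_{\mathrm{rlex}}$ be the reverse lexicographic order on the monomials $e_F=e_{i_1}\wedge\dots\wedge e_{i_r}$ ($F=\{i_1<\dots<i_r\}\subseteq\{1,\dots,n\}$) with respect to $e_1<\dots<e_n$: $e_G<_{\mathrm{rlex}}e_F$ if $|G|<|F|$, or if $|G|=|F|$, $G\ne F$ and the smallest element of $(G\setminus F)\cup(F\setminus G)$ lies in $G$. For a linear form $v\in E_1$ and a graded $E$-module $M$, let $H^j(M,v)$ ($j\in\mathbb Z$) be the homology in degree $j$ of the complex $\cdots\to M_{j-1}\xrightarrow{\cdot v}M_j\xrightarrow{\cdot v}M_{j+1}\to\cdots$. For a basis $v_1,\dots,v_n$ of $E_1$ the exterior annihilator numbers of $M$ are $$\alpha_{i,j}(v_1,\dots,v_n;M)=\dim_K H^j\bigl(M/(v_1,\dots,v_{i-1})M,\;v_i\bigr)\qquad(1\le i\le n,\ j\in\mathbb Z).$$ A matrix $\gamma=(\gamma_{r,s})\in GL_n(K)$ acts on $E$ by the algebra automorphism with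 $\gamma(e_s)=\sum_{r=1}^n\gamma_{r,s}e_r$. For a graded ideal $J\subseteq E$, let $\mathrm{gin}(J)$ be its generic initial ideal with respect to $<_{\mathrm{rlex}}$, i.e. the ideal that equals the initial ideal $\mathrm{in}_{<_{\mathrm{rlex}}}(\varphi(J))$ for all $\varphi$ in some non-empty Zariski-open subset of $GL_n(K)$, and define the exterior generic annihilator numbers of $E/J$ as $\alpha_{i,j}(E/J)=\alpha_{i,j}(e_1,\dots,e_n;E/\mathrm{gin}(J))$. **Theorem.** Let $J\subseteq E$ be a graded ideal. Suppose that $K$ is an extension of a field $k$ and contains $n^2$ elements that are algebraically independent over $k$. Then there exists a non-empty Zariski-open set $V\subseteq GL_n(K)$ such that $$\alpha_{i,j}(E/J)=\alpha_{i,j}\bigl(\gamma(e_{\sigma(1)}),\dots,\gamma(e_{\sigma(n)});E/J\bigr)$$ for all $\gamma\in V$, all permutations $\sigma$ of $\{1,\dots,n\}$, all $1\le i\le n$ and all $j\in\mathbb Z$. -/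

import Mathlib

open scoped Matrix

noncomputable section

namespace ExteriorAnnihilator

/-- The exterior algebra `E = K⟨e_1, …, e_n⟩` of the vector space `K ^ n`. -/
abbrev Ext (K : Type*) [Field K] (n : ℕ) : Type _ := ExteriorAlgebra K (Fin n → K)

/-- The standard grading of `E`, indexed by the natural numbers. -/
abbrev extGrading (K : Type*) [Field K] (n : ℕ) : ℕ → Submodule K (Ext K n) :=
  fun j => ⋀[K]^j (Fin n → K)

/-- The graded piece `E_j` for an integer `j`; it is zero for negative `j`. -/
def extDeg (K : Type*) [Field K] (n : ℕ) (j : ℤ) : Submodule K (Ext K n) :=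
  if 0 ≤ j then extGrading K n j.toNat else ⊥

/-- The standard basis vector `e_i` of `E_1 = K ^ n`. -/
def stdVec (K : Type*) [Field K] (n : ℕ) (i : Fin n) : Fin n → K := Pi.single i 1

section AnnihilatorNumbers

variable {K : Type*} [Field K] {n : ℕ}
variable {M : Type*} [AddCommGroup M] [Module K M] [Module (Ext K n) M]
  [IsScalarTower K (Ext K n) M]

/-- Multiplication by the linear form `v ∈ E_1 = K ^ n` on an `E`-module `M`, as a `K`-linear map. -/
def mulForm (M : Type*) [AddCommGroup M] [Module K M] [Module (Ext K n) M]
    [IsScalarTower K (Ext K n) M] (v : Fin n → K) : M →ₗ[K] M where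
  toFun m := (ExteriorAlgebra.ι K v : Ext K n) • m
  map_add' := smul_add _
  map_smul' c m := by
    rw [RingHom.id_apply, ← algebraMap_smul (Ext K n) c m, ← algebraMap_smul (Ext K n) c,
      smul_smul, smul_smul, Algebra.commutes]

/-- The cycles in degree `j` of the complex `… ⟶ M_{j-1} ⟶ M_j ⟶ M_{j+1} ⟶ …` whose differential is
multiplication by the linear form `v`. Here `gr j` is the graded piece `M_j`. -/
def cycles (gr : ℤ → Submodule K M) (v : Fin n → K) (j : ℤ) : Submodule K M :=
  gr j ⊓ LinearMap.ker (mulForm M v)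

/-- The boundaries `v · M_{j-1}` in degree `j` of the same complex. -/
def boundaries (gr : ℤ → Submodule K M) (v : Fin n → K) (j : ℤ) : Submodule K M :=
  (gr (j - 1)).map (mulForm M v)

/-- The homology `H^j(M, v)`: cycles modulo boundaries. -/
abbrev formHomology (gr : ℤ → Submodule K M) (v : Fin n → K) (j : ℤ) : Type _ :=
  cycles gr v j ⧸ (boundaries gr v j).submoduleOf (cycles gr v j)

/-- The submodule `(v_1, …, v_{i-1}) M` of `M`. -/
def initialSubmodule (M : Type*) [AddCommGroup M] [Module (Ext K n) M]
    (v : Fin n → Fin n → K) (i : Fin n) : Submodule (Ext K n) M :=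
  Ideal.span {x : Ext K n | ∃ l : Fin n, l < i ∧ x = ExteriorAlgebra.ι K (v l)} •
    (⊤ : Submodule (Ext K n) M)

/-- The grading induced on the quotient of a graded `E`-module by a submodule. -/
def quotGrading (gr : ℤ → Submodule K M) (N : Submodule (Ext K n) M) (j : ℤ) :
    Submodule K (M ⧸ N) :=
  (gr j).map (N.mkQ.restrictScalars K)

/-- The exterior annihilator number
`α_{i,j}(v_1, …, v_n; M) = dim_K H^j(M / (v_1, …, v_{i-1}) M, v_i)` of a graded `E`-module `M` with
graded pieces `gr j`, with respect to a sequence of `n` linear forms. -/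
def annihilatorNumber (gr : ℤ → Submodule K M) (v : Fin n → Fin n → K) (i : Fin n) (j : ℤ) : ℕ :=
  Module.finrank K (formHomology (quotGrading gr (initialSubmodule M v i)) (v i) j)

/-- `α_{i,j}(v_1, …, v_n; E/J)`. -/
def annihilatorNumberQuot (J : Ideal (Ext K n)) (v : Fin n → Fin n → K) (i : Fin n) (j : ℤ) : ℕ :=
  annihilatorNumber (quotGrading (extDeg K n) J) v i j

end AnnihilatorNumbers

section GenericInitialIdeal

variable {K : Type*} [Field K] {n : ℕ}

/-- The monomial `e_F = e_{i_1} ∧ … ∧ e_{i_r}` for `F = {i_1 < … < i_r}`. -/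
def monomial (K : Type*) [Field K] {n : ℕ} (F : Finset (Fin n)) : Ext K n :=
  ((F.sort (· ≤ ·)).map fun i => (ExteriorAlgebra.ι K (stdVec K n i) : Ext K n)).prod

/-- `e_G < e_F` in the (degree) reverse lexicographic order with `e_1 < … < e_n`: either `e_G` has
smaller degree, or the degrees agree and the smallest index at which `G` and `F` differ (the one of
the smallest variable occurring in just one of them) lies in `G`. -/
def RevLexLT {n : ℕ} (G F : Finset (Fin n)) : Prop :=
  G.card < F.card ∨
    (G.card = F.card ∧ ∃ i, i ∈ G ∧ i ∉ F ∧ ∀ l, l < i → (l ∈ G ↔ l ∈ F))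

/-- `e_F` is the initial monomial of `f`: `f` is a nonzero multiple of `e_F` plus a linear
combination of smaller monomials. -/
def IsInitialMonomial (f : Ext K n) (F : Finset (Fin n)) : Prop :=
  ∃ c : K, c ≠ 0 ∧
    f - c • monomial K F ∈ Submodule.span K (monomial K '' {G : Finset (Fin n) | RevLexLT G F})

/-- The initial ideal of `J`, generated by the initial monomials of the elements of `J`. -/
def initialIdeal (J : Ideal (Ext K n)) : Ideal (Ext K n) :=
  Ideal.span {x | ∃ f ∈ J, ∃ F, IsInitialMonomial f F ∧ x = monomial K F}

/-- The Zariski-open subsets of `GL_n(K)`: the loci where not all members of some set of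
polynomials in the matrix entries vanish. -/
def IsZariskiOpen (U : Set (GL (Fin n) K)) : Prop :=
  ∃ S : Set (MvPolynomial (Fin n × Fin n) K),
    U = {g | ∃ p ∈ S, MvPolynomial.eval (fun q : Fin n × Fin n => g.1 q.1 q.2) p ≠ 0}

/-- The image `g(v)` of a linear form `v`; thus `g(e_j) = ∑ i, g_{i,j} e_i`. -/
def actForm (g : GL (Fin n) K) (v : Fin n → K) : Fin n → K := Matrix.toLin' g.1 v

/-- The image `g(J)` of an ideal under the algebra automorphism of `E` induced by `g`. -/
def actIdeal (g : GL (Fin n) K) (J : Ideal (Ext K n)) : Ideal (Ext K n) :=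
  J.map (ExteriorAlgebra.map (Matrix.toLin' g.1))

/-- `I` is the initial ideal of `g(J)` for generic `g`, i.e. for all `g` in some non-empty
Zariski-open subset of `GL_n(K)`. -/
def IsGenericInitialIdeal (J I : Ideal (Ext K n)) : Prop :=
  ∃ U : Set (GL (Fin n) K), IsZariskiOpen U ∧ U.Nonempty ∧
    ∀ g ∈ U, initialIdeal (actIdeal g J) = I

open Classical in
/-- The generic initial ideal of `J` with respect to the reverse lexicographic order with
`e_1 < … < e_n`. (Over an infinite field and for graded `J` there is exactly one ideal as in
`IsGenericInitialIdeal`; the other branch of the case distinction is a default value.) -/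
def gin (J : Ideal (Ext K n)) : Ideal (Ext K n) :=
  if h : ∃ I, IsGenericInitialIdeal J I then h.choose else ⊥

/-- The exterior generic annihilator number
`α_{i,j}(E/J) = α_{i,j}(e_1, …, e_n; E/gin(J))`. -/
def genericAnnihilatorNumber (J : Ideal (Ext K n)) (i : Fin n) (j : ℤ) : ℕ :=
  annihilatorNumberQuot (gin J) (stdVec K n) i j

end GenericInitialIdeal

end ExteriorAnnihilator

end

/-!
The annihilator numbers of `E/J` with respect to linear forms `v_1, …, v_n` depend only on the
dimensions of the graded pieces of the ideals `J + (v_1, …, v_m)`: the homology of multiplication by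
`v_i` on `M = E/(J + (v_1, …, v_{i-1}))` in degree `j` has the dimension of `M_j` minus the ranks of
the maps out of and into `M_j`, and the rank of `M_j ⟶ M_{j+1}` is `dim M_{j+1} - dim (M / v_i M)_{j+1}` (`annihilatorNumberQuot_add`).

For the variables `e_1, …, e_n` these dimensions do not change when a homogeneous ideal is replaced
by its initial ideal. The monomials meeting `{e_1, …, e_m}` are the smallest of their degree in the
reverse lexicographic order, so the initial monomials of `J + (e_1, …, e_m)` are those of `J`
together with the monomials meeting `{e_1, …, e_m}` (`initialSet_idealDeg_sup`), and the dimension of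
a space is the number of its initial monomials (`finrank_eq_ncard_leadSet`).

Let `U` be a nonempty Zariski-open set on which `in(g(J)) = gin(J)`. If `P` is the permutation matrix
of `σ` and `g = (γ P)⁻¹` lies in `U`, then `g` carries `γ(e_{σ(1)}), …, γ(e_{σ(n)})` to
`e_1, …, e_n`, hence `α(γ(e_σ); E/J) = α(e; E/g(J)) = α(e; E/in(g(J))) = α(e; E/gin(J))`. The set `V`
is the intersection over `σ` of the conditions `(γ P)⁻¹ ∈ U`. They are Zariski-open and nonempty, and
since `K` is infinite (unless `n = 0`), finitely many such sets have a common point. The existence of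
`U` comes from the maximality of ranks on open sets: the dimension of the image of `g(J)` modulo a
span of monomials is generically constant, and these dimensions determine the initial monomials of
`g(J)` (`exists_isGenericInitialIdeal`). The algebraically independent elements serve only to make
`K` infinite.
-/

noncomputable section

namespace ExteriorAnnihilator

/-! ### Monomials in the exterior algebra -/

section Monomials

variable {K : Type*} [Field K] {n : ℕ}

variable (K n) in
/-- The basis of `E` formed by the monomials `e_F`. -/
def monomialBasis : Module.Basis (Finset (Fin n)) K (Ext K n) :=
  (Pi.basisFun K (Fin n)).ExteriorAlgebra

theorem monomialBasis_apply (F : Finset (Fin n)) :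
    monomialBasis K n F = monomial K F := by
  rw [monomialBasis, ExteriorAlgebra.basis_apply_ofCard _ (rfl : F.card = F.card)]
  simp only [ExteriorAlgebra.ιMulti_family, monomial, ExteriorAlgebra.ιMulti_apply,
    Set.powersetCard.ofFinEmbEquiv_symm_apply, stdVec, Function.comp_apply, Pi.basisFun_apply,
    Set.powersetCard.val_ofCard]
  congr 1
  refine List.ext_getElem (by simp) fun i h₁ h₂ => ?_
  simp [Finset.orderEmbOfFin_apply]

/-- Reordering the factors of a product of variables changes it at most by a sign. -/
theorem prod_map_ι_perm {l l' : List (Fin n)} (h : l.Perm l') :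
    (l.map fun i => (ExteriorAlgebra.ι K (stdVec K n i) : Ext K n)).prod =
        (l'.map fun i => (ExteriorAlgebra.ι K (stdVec K n i) : Ext K n)).prod ∨
      (l.map fun i => (ExteriorAlgebra.ι K (stdVec K n i) : Ext K n)).prod =
        -(l'.map fun i => (ExteriorAlgebra.ι K (stdVec K n i) : Ext K n)).prod := by
  induction h with
  | nil => simp
  | cons x _ ih => rcases ih with ih | ih <;> simp [ih]
  | swap x y l =>
    right
    have := ExteriorAlgebra.ι_add_mul_swap (R := K) (stdVec K n x) (stdVec K n y)
    rw [add_comm] at this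
    simp only [List.map_cons, List.prod_cons, ← mul_assoc, eq_neg_of_add_eq_zero_left this, neg_mul]
  | trans _ _ ih ih' =>
    rcases ih with ih | ih <;> rcases ih' with ih' | ih' <;> simp [ih, ih']

theorem ι_mul_monomial_of_mem {l : Fin n} {F : Finset (Fin n)} (h : l ∈ F) :
    (ExteriorAlgebra.ι K (stdVec K n l) : Ext K n) * monomial K F = 0 := by
  have hp : (F.sort (· ≤ ·)).Perm (l :: (F.erase l).sort (· ≤ ·)) := by
    rw [List.perm_ext_iff_of_nodup (Finset.sort_nodup _ _)
      (List.nodup_cons.2 ⟨by simp, Finset.sort_nodup _ _⟩)]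
    intro a
    by_cases hal : a = l <;> simp [hal, h]
  rcases prod_map_ι_perm (K := K) hp with e | e <;>
    rw [monomial, e] <;>
    simp [← mul_assoc]

theorem ι_mul_monomial_of_notMem {l : Fin n} {F : Finset (Fin n)} (h : l ∉ F) :
    (ExteriorAlgebra.ι K (stdVec K n l) : Ext K n) * monomial K F = monomial K (insert l F) ∨
      (ExteriorAlgebra.ι K (stdVec K n l) : Ext K n) * monomial K F =
        -monomial K (insert l F) := by
  have hp : (l :: F.sort (· ≤ ·)).Perm ((insert l F).sort (· ≤ ·)) := by
    rw [List.perm_ext_iff_of_nodup (List.nodup_cons.2 ⟨by simpa, Finset.sort_nodup _ _⟩)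
      (Finset.sort_nodup _ _)]
    simp
  simp only [← List.prod_cons, monomial]
  exact prod_map_ι_perm (K := K) hp

theorem monomial_mem (F : Finset (Fin n)) : monomial K F ∈ extGrading K n F.card := by
  rw [monomial, ← Finset.length_sort (· ≤ ·)]
  generalize F.sort (· ≤ ·) = l
  induction l with
  | nil => exact SetLike.GradedOne.one_mem (A := extGrading K n)
  | cons a l ih =>
    rw [List.map_cons, List.prod_cons, List.length_cons, add_comm]
    refine SetLike.mul_mem_graded ?_ ih
    simp [extGrading]

theorem ι_eq_sum (v : Fin n → K) :
    (ExteriorAlgebra.ι K v : Ext K n) = ∑ l, v l • ExteriorAlgebra.ι K (stdVec K n l) := by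
  conv_lhs => rw [pi_eq_sum_univ' v]
  simp only [map_sum, map_smul]
  refine Finset.sum_congr rfl fun l _ => ?_
  congr 2

/-- A subspace stable under left multiplication by the variables is a left ideal. -/
theorem mul_mem_of_ι_mul_mem {T : Submodule K (Ext K n)}
    (hT : ∀ l, ∀ x ∈ T, ExteriorAlgebra.ι K (stdVec K n l) * x ∈ T) (a : Ext K n) {x : Ext K n}
    (hx : x ∈ T) : a * x ∈ T := by
  induction a using ExteriorAlgebra.induction generalizing x with
  | algebraMap r => rw [← Algebra.smul_def]; exact T.smul_mem _ hx
  | ι v =>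
    rw [ι_eq_sum, Finset.sum_mul]
    refine T.sum_mem fun l _ => ?_
    rw [smul_mul_assoc]
    exact T.smul_mem _ (hT l x hx)
  | mul a b ha hb => rw [mul_assoc]; exact ha (hb hx)
  | add a b ha hb => rw [add_mul]; exact T.add_mem (ha hx) (hb hx)

theorem decompose_monomial (F : Finset (Fin n)) (j : ℕ) :
    (DirectSum.decompose (extGrading K n) (monomial K F) j : Ext K n) =
      if F.card = j then monomial K F else 0 := by
  split_ifs with h
  · subst h
    exact DirectSum.decompose_of_mem_same _ (monomial_mem F)
  · exact DirectSum.decompose_of_mem_ne _ (monomial_mem F) h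

/-- Homogeneous components of an element involve only monomials of that element. -/
theorem decompose_mem_span {s : Set (Finset (Fin n))} {x : Ext K n}
    (hx : x ∈ Submodule.span K (monomial K '' s)) (j : ℕ) :
    (DirectSum.decompose (extGrading K n) x j : Ext K n) ∈
      Submodule.span K (monomial K '' {F | F ∈ s ∧ F.card = j}) := by
  suffices h : Submodule.span K (monomial K '' s) ≤
      (Submodule.span K (monomial K '' {F | F ∈ s ∧ F.card = j})).comap
        (GradedAlgebra.proj (extGrading K n) j) from h hx
  rw [Submodule.span_le]
  rintro _ ⟨F, hF, rfl⟩
  rw [SetLike.mem_coe, Submodule.mem_comap, GradedAlgebra.proj_apply, decompose_monomial]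
  split_ifs with h
  · exact Submodule.subset_span ⟨F, ⟨hF, h⟩, rfl⟩
  · exact Submodule.zero_mem _

theorem span_monomial_univ :
    Submodule.span K (monomial K '' (Set.univ : Set (Finset (Fin n)))) = ⊤ := by
  rw [← (monomialBasis K n).span_eq, Set.image_univ]
  congr 2
  exact funext fun F => (monomialBasis_apply F).symm

theorem extGrading_eq_span (j : ℕ) :
    extGrading K n j = Submodule.span K (monomial K '' {F : Finset (Fin n) | F.card = j}) := by
  refine le_antisymm (fun x hx => ?_) (Submodule.span_le.2 ?_)
  · rw [← DirectSum.decompose_of_mem_same (extGrading K n) hx]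
    have := decompose_mem_span (x := x) (s := Set.univ) (by rw [span_monomial_univ]; trivial) j
    simpa using this
  · rintro _ ⟨F, rfl, rfl⟩
    exact monomial_mem F

theorem repr_monomial (F : Finset (Fin n)) :
    (monomialBasis K n).repr (monomial K F) = Finsupp.single F 1 := by
  rw [← monomialBasis_apply, Module.Basis.repr_self]

theorem mem_span_monomial {s : Set (Finset (Fin n))} {x : Ext K n} :
    x ∈ Submodule.span K (monomial K '' s) ↔ ∀ F, (monomialBasis K n).repr x F ≠ 0 → F ∈ s := by
  have : monomial K '' s = monomialBasis K n '' s :=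
    Set.image_congr fun F _ => (monomialBasis_apply F).symm
  rw [this, Module.Basis.mem_span_image]
  simp [Set.subset_def]

end Monomials

/-! ### Leading indices and dimensions -/

section Leading

variable {ι K V : Type*} [Field K] [AddCommGroup V] [Module K V]

/-- The indices `i` for which some element of `W` is a nonzero multiple of `b i` plus a combination
of `b l` with `r l i`: the set of leading indices of `W` with respect to the basis `b` and the
relation `r`. -/
def leadSet (b : Module.Basis ι K V) (r : ι → ι → Prop) (W : Submodule K V) : Set ι :=
  {i | ∃ f ∈ W, b.repr f i ≠ 0 ∧ ∀ l, b.repr f l ≠ 0 → l = i ∨ r l i}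

/-- The elements of `W` whose coordinates outside of `D` vanish. -/
def supportedIn (b : Module.Basis ι K V) (W : Submodule K V) (D : Set ι) : Submodule K V :=
  W ⊓ Submodule.span K (b '' D)

theorem mem_supportedIn {b : Module.Basis ι K V} {W : Submodule K V} {D : Set ι} {x : V} :
    x ∈ supportedIn b W D ↔ x ∈ W ∧ ∀ l, b.repr x l ≠ 0 → l ∈ D := by
  rw [supportedIn, Submodule.mem_inf, Module.Basis.mem_span_image]
  simp [Set.subset_def]

variable [Finite ι]

open Classical in
/-- The coordinate at `i` is a linear form on the elements of `W` supported in `{l | l ≤ i}`. Its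
kernel consists of those supported in `{l | l < i}`, and it is nonzero exactly when `i` is a leading
index. -/
theorem finrank_supportedIn_insert (b : Module.Basis ι K V) (r : ι → ι → Prop)
    [IsStrictTotalOrder ι r] (W : Submodule K V) (i : ι) :
    Module.finrank K (supportedIn b W {l | l = i ∨ r l i}) =
      Module.finrank K (supportedIn b W {l | r l i}) + if i ∈ leadSet b r W then 1 else 0 := by
  have : FiniteDimensional K V := Module.Finite.of_basis b
  set W' := supportedIn b W {l | l = i ∨ r l i} with hW'
  let φ : W' →ₗ[K] K := (b.coord i).comp W'.subtype
  have hker : (LinearMap.ker φ).map W'.subtype = supportedIn b W {l | r l i} := by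
    ext x
    simp only [Submodule.mem_map, LinearMap.mem_ker, Submodule.subtype_apply, Subtype.exists,
      exists_and_right, exists_eq_right, φ, LinearMap.comp_apply, Module.Basis.coord_apply]
    constructor
    · rintro ⟨hx, h0⟩
      rw [hW', mem_supportedIn] at hx
      refine mem_supportedIn.2 ⟨hx.1, fun l hl => ?_⟩
      rcases hx.2 l hl with rfl | h
      · exact absurd h0 hl
      · exact h
    · intro hx
      rw [mem_supportedIn] at hx
      refine ⟨mem_supportedIn.2 ⟨hx.1, fun l hl => Or.inr (hx.2 l hl)⟩, ?_⟩
      by_contra h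
      exact irrefl_of r i (hx.2 i h)
  have h1 := φ.finrank_range_add_finrank_ker
  have hlead : i ∈ leadSet b r W ↔ φ ≠ 0 := by
    rw [Ne, LinearMap.ext_iff, not_forall]
    constructor
    · rintro ⟨f, hf, hfi, hfl⟩
      exact ⟨⟨f, mem_supportedIn.2 ⟨hf, hfl⟩⟩, hfi⟩
    · rintro ⟨⟨f, hf⟩, hfi⟩
      exact ⟨f, (mem_supportedIn.1 hf).1, hfi, (mem_supportedIn.1 hf).2⟩
  rw [← hker, Submodule.finrank_map_subtype_eq, ← h1, add_comm]
  congr 1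
  split_ifs with h
  · rw [LinearMap.range_eq_top.2 (LinearMap.surjective (hlead.1 h)), finrank_top,
      Module.finrank_self]
  · rw [not_not.1 (fun h' => h (hlead.2 h')), LinearMap.range_zero, finrank_bot]

/-- The dimension of a subspace is the number of its leading indices. -/
theorem finrank_eq_ncard_leadSet (b : Module.Basis ι K V) (r : ι → ι → Prop)
    [IsStrictTotalOrder ι r] (W : Submodule K V) :
    Module.finrank K W = (leadSet b r W).ncard := by
  classical
  cases nonempty_fintype ι
  let : LinearOrder ι := linearOrderOfSTO r
  have key : ∀ (m : ℕ) (D : Finset ι), D.card = m → (∀ i ∈ D, ∀ l, r l i → l ∈ D) →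
      Module.finrank K (supportedIn b W D) = (leadSet b r W ∩ D).ncard := by
    intro m
    induction m with
    | zero =>
      intro D hD _
      rw [Finset.card_eq_zero] at hD
      subst hD
      rw [Finset.coe_empty, supportedIn, Set.image_empty, Submodule.span_empty, inf_bot_eq,
        finrank_bot, Set.inter_empty, Set.ncard_empty]
    | succ m ih =>
      intro D hD hlow
      have hne : D.Nonempty := Finset.card_pos.1 (by omega)
      obtain ⟨i, hi, hmax⟩ : ∃ i ∈ D, ∀ l ∈ D, l = i ∨ r l i := by
        refine ⟨D.max' hne, D.max'_mem hne, fun l hl => ?_⟩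
        exact (D.le_max' l hl).eq_or_lt
      have hD1 : (D : Set ι) = {l | l = i ∨ r l i} := by
        ext l
        refine ⟨hmax l, ?_⟩
        rintro (rfl | h)
        exacts [hi, hlow i hi l h]
      have hD2 : ((D.erase i : Finset ι) : Set ι) = {l | r l i} := by
        ext l
        simp only [Finset.coe_erase, hD1, Set.mem_sdiff, Set.mem_ofPred_eq, Set.mem_singleton_iff]
        constructor
        · rintro ⟨h | h, h'⟩
          exacts [absurd h h', h]
        · intro h
          exact ⟨Or.inr h, fun e => irrefl_of r i (e ▸ h)⟩
      have := ih (D.erase i) (by rw [Finset.card_erase_of_mem hi, hD]; rfl) (by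
        intro a ha l hl
        have ha' : r a i := by
          have : a ∈ ((D.erase i : Finset ι) : Set ι) := ha
          rwa [hD2] at this
        have : l ∈ ((D.erase i : Finset ι) : Set ι) := by
          rw [hD2]; exact trans_of r hl ha'
        exact this)
      rw [hD1, finrank_supportedIn_insert, ← hD2, this, hD2]
      have e : {l | l = i ∨ r l i} = insert i {l | r l i} := rfl
      split_ifs with h
      · rw [e, Set.inter_insert_of_mem h, Set.ncard_insert_of_notMem]
        exact fun h' => irrefl_of r i h'.2
      · rw [e, Set.inter_insert_of_notMem h, add_zero]
  have := key _ Finset.univ rfl (by simp)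
  rwa [Finset.coe_univ, supportedIn, Set.image_univ, b.span_eq, inf_top_eq, Set.inter_univ] at this

/-- The leading indices of `W` are determined by the dimensions of its subspaces of elements
supported in the various sets of indices. -/
theorem leadSet_eq_of_finrank_eq (b : Module.Basis ι K V) (r : ι → ι → Prop)
    [IsStrictTotalOrder ι r] {W W' : Submodule K V}
    (h : ∀ D, Module.finrank K (supportedIn b W D) = Module.finrank K (supportedIn b W' D)) :
    leadSet b r W = leadSet b r W' := by
  classical
  ext i
  have h1 := finrank_supportedIn_insert b r W i
  have h2 := finrank_supportedIn_insert b r W' i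
  rw [h, h] at h1
  rw [h1] at h2
  have h3 := Nat.add_left_cancel h2
  by_cases hi : i ∈ leadSet b r W <;> by_cases hi' : i ∈ leadSet b r W' <;> simp [hi, hi'] at h3 ⊢

end Leading

/-! ### Initial ideals in the reverse lexicographic order -/

section InitialIdeals

variable {K : Type*} [Field K] {n : ℕ}

instance : IsStrictTotalOrder (Finset (Fin n)) RevLexLT where
  irrefl F h := by
    rcases h with h | ⟨-, i, h, h', -⟩
    exacts [lt_irrefl _ h, h' h]
  trans F G H h h' := by
    rcases h with h | ⟨hc, i, hi, hi', hl⟩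
    · rcases h' with h' | ⟨hc', -⟩
      · exact Or.inl (h.trans h')
      · exact Or.inl (hc' ▸ h)
    · rcases h' with h' | ⟨hc', i', hk, hk', hl'⟩
      · exact Or.inl (hc ▸ h')
      · refine Or.inr ⟨hc.trans hc', ?_⟩
        rcases lt_trichotomy i i' with hii | rfl | hii
        · exact ⟨i, hi, fun h => hi' ((hl' i hii).2 h),
            fun l h => (hl l h).trans (hl' l (h.trans hii))⟩
        · exact absurd hk hi'
        · exact ⟨i', (hl i' hii).2 hk, hk', fun l h => (hl l (h.trans hii)).trans (hl' l h)⟩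
  trichotomous F G h h' := by
    by_contra hne
    have hc : F.card = G.card := by
      by_contra hc
      rcases lt_or_gt_of_ne hc with hc | hc
      exacts [h (Or.inl hc), h' (Or.inl hc)]
    have hd : (symmDiff F G).Nonempty := by
      rw [Finset.nonempty_iff_ne_empty]
      exact fun h => hne (symmDiff_eq_bot.1 h)
    have hmin : ∀ l, l < (symmDiff F G).min' hd → (l ∈ F ↔ l ∈ G) := by
      intro l hl
      by_contra hlFG
      have : l ∈ symmDiff F G := by rw [Finset.mem_symmDiff]; tauto
      exact absurd ((symmDiff F G).min'_le l this) (not_le.2 hl)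
    rcases Finset.mem_symmDiff.1 ((symmDiff F G).min'_mem hd) with ⟨h1, h2⟩ | ⟨h1, h2⟩
    · exact h (Or.inr ⟨hc, _, h1, h2, hmin⟩)
    · exact h' (Or.inr ⟨hc.symm, _, h1, h2, fun l hl => (hmin l hl).symm⟩)

theorem RevLexLT.insert {F G : Finset (Fin n)} {l : Fin n} (h : RevLexLT G F) (hF : l ∉ F)
    (hG : l ∉ G) : RevLexLT (insert l G) (insert l F) := by
  rcases h with h | ⟨hc, i, hi, hi', hl⟩
  · left
    rw [Finset.card_insert_of_notMem hF, Finset.card_insert_of_notMem hG]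
    omega
  · right
    refine ⟨by rw [Finset.card_insert_of_notMem hF, Finset.card_insert_of_notMem hG, hc], i,
      Finset.mem_insert_of_mem hi, ?_, fun a ha => ?_⟩
    · rw [Finset.mem_insert, not_or]
      exact ⟨fun h => hG (h ▸ hi), hi'⟩
    · simp [hl a ha]

/-- In the reverse lexicographic order the monomials divisible by one of the first `m` variables
are smaller than the other monomials of the same degree. -/
theorem RevLexLT.of_meets {F G : Finset (Fin n)} {m : ℕ} (hc : G.card = F.card)
    (hG : ∃ l ∈ G, l.val < m) (hF : ¬ ∃ l ∈ F, l.val < m) : RevLexLT G F := by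
  obtain ⟨l, hl, hlm⟩ := hG
  have hmin : (G.min' ⟨l, hl⟩).val < m := lt_of_le_of_lt (G.min'_le l hl) hlm
  refine Or.inr ⟨hc, G.min' ⟨l, hl⟩, G.min'_mem _, fun h => hF ⟨_, h, hmin⟩, fun a ha => ?_⟩
  refine iff_of_false (fun h => absurd (G.min'_le a h) (not_le.2 ha))
    fun h => hF ⟨a, h, lt_trans ha hmin⟩

/-- Initial monomials in terms of coordinates: `e_F` occurs in `f`, and every other monomial of `f`
is smaller. -/
theorem isInitialMonomial_iff {f : Ext K n} {F : Finset (Fin n)} :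
    IsInitialMonomial f F ↔ (monomialBasis K n).repr f F ≠ 0 ∧
      ∀ G, (monomialBasis K n).repr f G ≠ 0 → G = F ∨ RevLexLT G F := by
  constructor
  · rintro ⟨c, hc, h⟩
    rw [mem_span_monomial] at h
    simp only [map_sub, map_smul, repr_monomial, Finsupp.smul_single, smul_eq_mul, mul_one,
      Finsupp.sub_apply, Set.mem_ofPred_eq] at h
    constructor
    · intro h0
      refine irrefl_of RevLexLT F (h F ?_)
      simpa [h0] using hc
    · intro G hG
      by_cases e : G = F
      · exact Or.inl e
      · refine Or.inr (h G ?_)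
        rwa [Finsupp.single_eq_of_ne e, sub_zero]
  · rintro ⟨h0, h⟩
    refine ⟨_, h0, ?_⟩
    rw [mem_span_monomial]
    intro G
    simp only [map_sub, map_smul, repr_monomial, Finsupp.smul_single, smul_eq_mul, mul_one,
      Finsupp.sub_apply, Set.mem_ofPred_eq]
    by_cases e : G = F
    · subst e; simp
    · rw [Finsupp.single_eq_of_ne e, sub_zero]
      exact fun hG => (h G hG).resolve_left e

/-- The set of the `F` such that `e_F` is the initial monomial of an element of `W`. -/
abbrev initialSet (W : Submodule K (Ext K n)) : Set (Finset (Fin n)) :=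
  leadSet (monomialBasis K n) RevLexLT W

theorem mem_initialSet {W : Submodule K (Ext K n)} {F : Finset (Fin n)} :
    F ∈ initialSet W ↔ ∃ f ∈ W, IsInitialMonomial f F := by
  simp only [isInitialMonomial_iff]
  rfl

theorem ι_mul_mem_span {s : Set (Finset (Fin n))} {T : Submodule K (Ext K n)} {l : Fin n}
    (hs : ∀ F ∈ s, l ∉ F → monomial K (insert l F) ∈ T) {x : Ext K n}
    (hx : x ∈ Submodule.span K (monomial K '' s)) :
    ExteriorAlgebra.ι K (stdVec K n l) * x ∈ T := by
  suffices h : Submodule.span K (monomial K '' s) ≤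
      T.comap (LinearMap.mulLeft K (ExteriorAlgebra.ι K (stdVec K n l))) from h hx
  rw [Submodule.span_le]
  rintro _ ⟨F, hF, rfl⟩
  rw [SetLike.mem_coe, Submodule.mem_comap, LinearMap.mulLeft_apply]
  by_cases h : l ∈ F
  · rw [ι_mul_monomial_of_mem h]
    exact Submodule.zero_mem _
  · rcases ι_mul_monomial_of_notMem (K := K) h with e | e <;> rw [e]
    · exact hs F hF h
    · exact Submodule.neg_mem _ (hs F hF h)

theorem mul_mem_span_monomial {s : Set (Finset (Fin n))}
    (hs : ∀ F ∈ s, ∀ l, l ∉ F → insert l F ∈ s) (a : Ext K n) {x : Ext K n}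
    (hx : x ∈ Submodule.span K (monomial K '' s)) :
    a * x ∈ Submodule.span K (monomial K '' s) :=
  mul_mem_of_ι_mul_mem (fun l _ hy =>
    ι_mul_mem_span (fun F hF hl => Submodule.subset_span (Set.mem_image_of_mem _ (hs F hF l hl)))
      hy) a hx

/-- A left ideal generated by monomials `e_F`, `F ∈ s`, is spanned by them if `s` is closed under
enlarging its members. -/
theorem ideal_span_monomial {s : Set (Finset (Fin n))}
    (hs : ∀ F ∈ s, ∀ l, l ∉ F → insert l F ∈ s) :
    (Ideal.span (monomial K '' s)).restrictScalars K = Submodule.span K (monomial K '' s) := by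
  refine le_antisymm (fun x hx => ?_) (Submodule.span_le.2 fun x hx => Ideal.subset_span hx)
  rw [Submodule.restrictScalars_mem] at hx
  induction hx using Submodule.span_induction with
  | mem x h => exact Submodule.subset_span h
  | zero => exact Submodule.zero_mem _
  | add x y _ _ hx hy => exact Submodule.add_mem _ hx hy
  | smul a x _ hx => exact mul_mem_span_monomial hs a hx

/-- Multiplying by a variable `e_l` with `l ∉ F` preserves the order between `e_F` and the monomials
not involving `e_l`, and it kills those that do; so `e_l f` has initial monomial `e_{F ∪ {l}}`. -/
theorem insert_mem_initialSet {I : Ideal (Ext K n)} {F : Finset (Fin n)}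
    (hF : F ∈ initialSet (I.restrictScalars K)) {l : Fin n} (hl : l ∉ F) :
    insert l F ∈ initialSet (I.restrictScalars K) := by
  rw [mem_initialSet] at hF ⊢
  obtain ⟨f, hf, c, hc, h⟩ := hF
  have h' := ι_mul_mem_span (T := Submodule.span K
    (monomial K '' {G | RevLexLT G (insert l F)})) (l := l) (fun G hG hlG =>
      Submodule.subset_span (Set.mem_image_of_mem _ (RevLexLT.insert hG hl hlG))) h
  rw [mul_sub, mul_smul_comm] at h'
  refine ⟨ExteriorAlgebra.ι K (stdVec K n l) * f, I.mul_mem_left _ hf, ?_⟩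
  rcases ι_mul_monomial_of_notMem (K := K) hl with e | e <;> rw [e] at h'
  · exact ⟨c, hc, h'⟩
  · exact ⟨-c, neg_ne_zero.2 hc, by simpa using h'⟩

theorem initialIdeal_eq_span (I : Ideal (Ext K n)) :
    initialIdeal I = Ideal.span (monomial K '' initialSet (I.restrictScalars K)) := by
  rw [initialIdeal]
  congr 1
  ext x
  simp only [Set.mem_ofPred_eq, Set.mem_image, mem_initialSet, Submodule.restrictScalars_mem]
  constructor
  · rintro ⟨f, hf, F, h, rfl⟩
    exact ⟨F, ⟨f, hf, h⟩, rfl⟩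
  · rintro ⟨F, ⟨f, hf, h⟩, rfl⟩
    exact ⟨f, hf, F, h, rfl⟩

theorem initialIdeal_restrictScalars (I : Ideal (Ext K n)) :
    (initialIdeal I).restrictScalars K =
      Submodule.span K (monomial K '' initialSet (I.restrictScalars K)) := by
  rw [initialIdeal_eq_span, ideal_span_monomial]
  exact fun F hF l hl => insert_mem_initialSet hF hl

theorem initialSet_span (s : Set (Finset (Fin n))) :
    initialSet (Submodule.span K (monomial K '' s)) = s := by
  ext F
  constructor
  · rintro ⟨f, hf, h0, -⟩
    exact mem_span_monomial.1 hf F h0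
  · intro hF
    refine ⟨monomial K F, Submodule.subset_span ⟨F, hF, rfl⟩, ?_⟩
    rw [repr_monomial]
    refine ⟨by simp, fun l hl => Or.inl ?_⟩
    by_contra h
    exact hl (Finsupp.single_eq_of_ne h)

theorem initialSet_initialIdeal (I : Ideal (Ext K n)) :
    initialSet ((initialIdeal I).restrictScalars K) = initialSet (I.restrictScalars K) := by
  rw [initialIdeal_restrictScalars, initialSet_span]

theorem initialIdeal_isHomogeneous (I : Ideal (Ext K n)) :
    (initialIdeal I).IsHomogeneous (extGrading K n) := by
  rw [initialIdeal_eq_span]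
  refine Ideal.homogeneous_span _ _ ?_
  rintro _ ⟨F, -, rfl⟩
  exact ⟨_, monomial_mem F⟩

/-- The left ideal generated by the first `m` of the linear forms `v`. -/
def formsIdeal (v : Fin n → Fin n → K) (m : ℕ) : Ideal (Ext K n) :=
  Ideal.span {x | ∃ l : Fin n, l.val < m ∧ x = ExteriorAlgebra.ι K (v l)}

theorem formsIdeal_isHomogeneous (v : Fin n → Fin n → K) (m : ℕ) :
    (formsIdeal v m).IsHomogeneous (extGrading K n) := by
  refine Ideal.homogeneous_span _ _ ?_
  rintro _ ⟨l, -, rfl⟩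
  exact ⟨1, by simp [extGrading]⟩

theorem monomial_singleton (l : Fin n) :
    monomial K {l} = ExteriorAlgebra.ι K (stdVec K n l) := by
  simp [monomial]

theorem monomial_mem_span_of_mem {F : Finset (Fin n)} {l : Fin n} (h : l ∈ F) :
    monomial K F ∈ Ideal.span {(ExteriorAlgebra.ι K (stdVec K n l) : Ext K n)} := by
  have hp : (F.sort (· ≤ ·)).Perm ((F.erase l).sort (· ≤ ·) ++ [l]) := by
    refine List.Perm.trans ?_ (List.perm_append_singleton _ _).symm
    rw [List.perm_ext_iff_of_nodup (Finset.sort_nodup _ _)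
      (List.nodup_cons.2 ⟨by simp, Finset.sort_nodup _ _⟩)]
    intro a
    by_cases hal : a = l <;> simp [hal, h]
  have key : ∀ a : Ext K n, a * ExteriorAlgebra.ι K (stdVec K n l) ∈
      Ideal.span {(ExteriorAlgebra.ι K (stdVec K n l) : Ext K n)} := fun a =>
    Ideal.mul_mem_left _ _ (Ideal.subset_span rfl)
  rcases prod_map_ι_perm (K := K) hp with e | e <;>
    rw [monomial, e, List.map_append, List.prod_append, List.map_singleton, List.prod_singleton]
  · exact key _
  · exact neg_mem (key _)

theorem formsIdeal_stdVec (m : ℕ) :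
    (formsIdeal (stdVec K n) m).restrictScalars K =
      Submodule.span K (monomial K '' {F | ∃ l ∈ F, l.val < m}) := by
  rw [← ideal_span_monomial]
  · congr 1
    refine le_antisymm (Ideal.span_le.2 ?_) (Ideal.span_le.2 ?_)
    · rintro _ ⟨l, hl, rfl⟩
      rw [← monomial_singleton]
      exact Ideal.subset_span ⟨_, ⟨l, by simp, hl⟩, rfl⟩
    · rintro _ ⟨F, ⟨l, hlF, hl⟩, rfl⟩
      refine Ideal.span_mono ?_ (monomial_mem_span_of_mem hlF)
      rw [Set.singleton_subset_iff]
      exact ⟨l, hl, rfl⟩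
  · rintro F ⟨l, hlF, hl⟩ a -
    exact ⟨l, Finset.mem_insert_of_mem hlF, hl⟩

/-- The degree `j` part of an ideal. -/
def idealDeg (I : Ideal (Ext K n)) (j : ℤ) : Submodule K (Ext K n) :=
  I.restrictScalars K ⊓ extDeg K n j

theorem extDeg_natCast (j : ℕ) : extDeg K n j = extGrading K n j := by
  simp [extDeg]

theorem extDeg_of_neg {j : ℤ} (h : j < 0) : extDeg K n j = ⊥ := by
  simp [extDeg, not_le.2 h]

/-- This is where the reverse lexicographic order enters: passing to the initial ideal commutes
with adding the ideal of the first variables, in each degree. -/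
theorem initialSet_idealDeg_sup {I : Ideal (Ext K n)} (hI : I.IsHomogeneous (extGrading K n))
    (m j : ℕ) :
    initialSet (idealDeg (I ⊔ formsIdeal (stdVec K n) m) j) =
      {F | F.card = j ∧ (F ∈ initialSet (I.restrictScalars K) ∨ ∃ l ∈ F, l.val < m)} := by
  have hP : ∀ x, x ∈ formsIdeal (stdVec K n) m ↔
      x ∈ Submodule.span K (monomial K '' {F | ∃ l ∈ F, l.val < m}) := fun x => by
    rw [← formsIdeal_stdVec, Submodule.restrictScalars_mem]
  ext F
  rw [Set.mem_ofPred_eq]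
  constructor
  · intro h
    obtain ⟨f, hf, hF⟩ := mem_initialSet.1 h
    rw [idealDeg, Submodule.mem_inf, Submodule.restrictScalars_mem, extDeg_natCast] at hf
    obtain ⟨hfI, hfj⟩ := hf
    have hc : F.card = j := by
      have h0 := (isInitialMonomial_iff.1 hF).1
      rw [extGrading_eq_span] at hfj
      exact mem_span_monomial.1 hfj F h0
    refine ⟨hc, ?_⟩
    by_cases hm : ∃ l ∈ F, l.val < m
    · exact Or.inr hm
    left
    obtain ⟨g, hg, p, hp, rfl⟩ := Submodule.mem_sup.1 hfI
    obtain ⟨c, hc0, hlt⟩ := hF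
    rw [mem_initialSet]
    refine ⟨DirectSum.decompose (extGrading K n) g j, hI j hg, c, hc0, ?_⟩
    -- The degree `j` part of `p` only involves monomials below `e_F`, as `F` avoids the first `m`
    -- indices, so subtracting it from `f` does not affect the initial monomial.
    have hp' := decompose_mem_span ((hP p).1 hp) j
    have e : (DirectSum.decompose (extGrading K n) g j : Ext K n) - c • monomial K F =
        (g + p - c • monomial K F) - DirectSum.decompose (extGrading K n) p j := by
      have := DirectSum.decompose_of_mem_same (extGrading K n) hfj
      rw [DirectSum.decompose_add, DirectSum.add_apply, Submodule.coe_add] at this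
      conv_rhs => rw [← this]
      abel
    rw [e]
    refine Submodule.sub_mem _ hlt (Submodule.span_mono ?_ hp')
    rintro _ ⟨G, ⟨hG, hGj⟩, rfl⟩
    exact ⟨G, RevLexLT.of_meets (hGj.trans hc.symm) hG hm, rfl⟩
  · rintro ⟨rfl, h⟩
    rcases h with h | h
    · obtain ⟨f, hf, c, hc, hlt⟩ := mem_initialSet.1 h
      rw [mem_initialSet]
      refine ⟨DirectSum.decompose (extGrading K n) f F.card, ?_, c, hc, ?_⟩
      · rw [idealDeg, extDeg_natCast]
        exact ⟨Submodule.mem_sup_left (hI _ hf), SetLike.coe_mem _⟩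
      · have := decompose_mem_span hlt F.card
        rw [DirectSum.decompose_sub, DirectSum.sub_apply, Submodule.coe_sub,
          DirectSum.decompose_of_mem_same _ (Submodule.smul_mem _ c (monomial_mem F))] at this
        refine Submodule.span_mono (Set.image_mono ?_) this
        exact fun G hG => hG.1
    · have : monomial K F ∈ idealDeg (I ⊔ formsIdeal (stdVec K n) m) F.card := by
        rw [idealDeg, extDeg_natCast]
        exact ⟨Submodule.mem_sup_right ((hP _).2 (Submodule.subset_span ⟨F, h, rfl⟩)),
          monomial_mem F⟩
      rw [mem_initialSet]
      exact ⟨_, this, 1, one_ne_zero, by simp⟩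

/-- The Hilbert functions of `I + (e_1, …, e_m)` and `in(I) + (e_1, …, e_m)` agree. -/
theorem finrank_idealDeg_initialIdeal {I : Ideal (Ext K n)}
    (hI : I.IsHomogeneous (extGrading K n)) (m : ℕ) (j : ℤ) :
    Module.finrank K (idealDeg (initialIdeal I ⊔ formsIdeal (stdVec K n) m) j) =
      Module.finrank K (idealDeg (I ⊔ formsIdeal (stdVec K n) m) j) := by
  rcases lt_or_ge j 0 with hj | hj
  · rw [idealDeg, idealDeg, extDeg_of_neg hj, inf_bot_eq, inf_bot_eq]
  · lift j to ℕ using hj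
    rw [finrank_eq_ncard_leadSet (monomialBasis K n) RevLexLT,
      finrank_eq_ncard_leadSet (monomialBasis K n) RevLexLT]
    change (initialSet _).ncard = (initialSet _).ncard
    rw [initialSet_idealDeg_sup hI, initialSet_idealDeg_sup (initialIdeal_isHomogeneous I),
      initialSet_initialIdeal]

end InitialIdeals

/-! ### Annihilator numbers and Hilbert functions -/

section HilbertFunctions

variable {K : Type*} [Field K] {n : ℕ}

theorem map_mem_extGrading (f : (Fin n → K) →ₗ[K] Fin n → K) {j : ℕ} {x : Ext K n}
    (hx : x ∈ extGrading K n j) : ExteriorAlgebra.map f x ∈ extGrading K n j := by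
  have h : (extGrading K n j).map (ExteriorAlgebra.map f).toLinearMap ≤ extGrading K n j := by
    rw [extGrading, ExteriorAlgebra.exteriorPower, Submodule.map_pow]
    refine pow_le_pow_left' ?_ j
    rintro _ ⟨_, ⟨v, rfl⟩, rfl⟩
    exact ⟨f v, by simp⟩
  exact h ⟨x, hx, rfl⟩

theorem map_mem_extDeg (f : (Fin n → K) →ₗ[K] Fin n → K) {j : ℤ} {x : Ext K n}
    (hx : x ∈ extDeg K n j) : ExteriorAlgebra.map f x ∈ extDeg K n j := by
  unfold extDeg at *
  split_ifs with h
  · rw [if_pos h] at hx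
    exact map_mem_extGrading f hx
  · rw [if_neg h, Submodule.mem_bot] at hx
    simp [hx]

/-- Moving a linear form past `x` replaces `x` by its image under the grade involution, the
automorphism that is `-1` on `E_1`. -/
theorem ι_mul_eq (v : Fin n → K) (x : Ext K n) :
    ExteriorAlgebra.ι K v * x =
      ExteriorAlgebra.map (-LinearMap.id) x * ExteriorAlgebra.ι K v := by
  induction x using ExteriorAlgebra.induction with
  | algebraMap r => simp [Algebra.commutes]
  | ι w =>
    have := ExteriorAlgebra.ι_add_mul_swap (R := K) v w
    simpa using eq_neg_of_add_eq_zero_left this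
  | mul a b ha hb => rw [← mul_assoc, ha, mul_assoc, hb, ← mul_assoc, map_mul]
  | add a b ha hb => rw [mul_add, ha, hb, map_add, add_mul]

theorem mul_ι_eq (v : Fin n → K) (x : Ext K n) :
    x * ExteriorAlgebra.ι K v =
      ExteriorAlgebra.ι K v * ExteriorAlgebra.map (-LinearMap.id) x := by
  rw [ι_mul_eq]
  congr 1
  rw [← AlgHom.comp_apply, ExteriorAlgebra.map_comp_map]
  simp

/-- The left ideal generated by linear forms is two-sided. -/
theorem mul_mem_formsIdeal (v : Fin n → Fin n → K) (m : ℕ) {r : Ext K n}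
    (hr : r ∈ formsIdeal v m) (y : Ext K n) : r * y ∈ formsIdeal v m := by
  rw [formsIdeal] at hr ⊢
  induction hr using Submodule.span_induction with
  | mem x h =>
    obtain ⟨l, hl, rfl⟩ := h
    rw [ι_mul_eq]
    exact Ideal.mul_mem_left _ _ (Ideal.subset_span ⟨l, hl, rfl⟩)
  | zero => simp
  | add a b _ _ ha hb => rw [add_mul]; exact add_mem ha hb
  | smul a x _ hx => rw [smul_eq_mul, mul_assoc]; exact Ideal.mul_mem_left _ _ hx

theorem formsIdeal_succ (v : Fin n → Fin n → K) (i : Fin n) :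
    formsIdeal v (i.val + 1) =
      formsIdeal v i.val ⊔ Ideal.span {(ExteriorAlgebra.ι K (v i) : Ext K n)} := by
  rw [formsIdeal, formsIdeal, ← Ideal.span_union]
  congr 1
  ext x
  simp only [Set.mem_ofPred_eq, Set.mem_union, Set.mem_singleton_iff, Order.lt_add_one_iff]
  constructor
  · rintro ⟨l, hl, rfl⟩
    rcases hl.lt_or_eq with h | h
    · exact Or.inl ⟨l, h, rfl⟩
    · exact Or.inr (by rw [Fin.ext h])
  · rintro (⟨l, hl, rfl⟩ | rfl)
    exacts [⟨l, hl.le, rfl⟩, ⟨i, le_rfl, rfl⟩]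

theorem ι_mul_mem_extDeg (v : Fin n → K) {j : ℤ} {x : Ext K n} (hx : x ∈ extDeg K n j) :
    ExteriorAlgebra.ι K v * x ∈ extDeg K n (j + 1) := by
  rcases lt_or_ge j 0 with hj | hj
  · rw [extDeg_of_neg hj, Submodule.mem_bot] at hx
    simp [hx]
  · lift j to ℕ using hj
    rw [extDeg_natCast] at hx
    have : ((j : ℤ) + 1) = ((1 + j : ℕ) : ℤ) := by push_cast; ring
    rw [this, extDeg_natCast]
    exact SetLike.mul_mem_graded (by simp [extGrading]) hx

/-- The degree `j + 1` part of `A + (v)` is the sum of those of `A` and `v E_j`. -/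
theorem exists_sub_ι_mul_mem {A : Ideal (Ext K n)} (hA : A.IsHomogeneous (extGrading K n))
    (v : Fin n → K) {j : ℤ} {f : Ext K n}
    (hf : f ∈ A ⊔ Ideal.span {(ExteriorAlgebra.ι K v : Ext K n)})
    (hfj : f ∈ extDeg K n (j + 1)) :
    ∃ x ∈ extDeg K n j, f - ExteriorAlgebra.ι K v * x ∈ A := by
  rcases lt_or_ge (j + 1) 0 with hj | hj
  · rw [extDeg_of_neg hj, Submodule.mem_bot] at hfj
    exact ⟨0, Submodule.zero_mem _, by simp [hfj]⟩
  obtain ⟨m, hm⟩ := Int.eq_ofNat_of_zero_le hj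
  rw [hm, extDeg_natCast] at hfj
  obtain ⟨a, ha, p, hp, rfl⟩ := Submodule.mem_sup.1 hf
  obtain ⟨y, rfl⟩ := Ideal.mem_span_singleton'.1 hp
  have hι : (ExteriorAlgebra.ι K v : Ext K n) ∈ extGrading K n 1 := by simp [extGrading]
  have h1 := DirectSum.decompose_of_mem_same (extGrading K n) hfj
  rw [DirectSum.decompose_add, DirectSum.add_apply, Submodule.coe_add] at h1
  -- In degree `0` the multiple of `v` does not contribute, so `f` itself lies in `A`.
  rcases Nat.eq_zero_or_pos m with rfl | hm0
  · refine ⟨0, Submodule.zero_mem _, ?_⟩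
    rw [DirectSum.coe_decompose_mul_of_right_mem_of_not_le _ hι (by simp)] at h1
    rw [← h1]
    simpa using hA 0 ha
  · rw [DirectSum.coe_decompose_mul_of_right_mem_of_le _ hι hm0, mul_ι_eq] at h1
    refine ⟨ExteriorAlgebra.map (-LinearMap.id)
      (DirectSum.decompose (extGrading K n) y (m - 1) : Ext K n), ?_, ?_⟩
    · have : j = ((m - 1 : ℕ) : ℤ) := by omega
      rw [this, extDeg_natCast]
      exact map_mem_extGrading _ (SetLike.coe_mem _)
    · rw [← h1, add_sub_cancel_right]
      exact hA m ha

theorem finrank_map_add_finrank_inf_ker {V W : Type*} [AddCommGroup V] [Module K V]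
    [AddCommGroup W] [Module K W] [FiniteDimensional K V] (f : V →ₗ[K] W) (S : Submodule K V) :
    Module.finrank K (S.map f) + Module.finrank K (S ⊓ LinearMap.ker f : Submodule K V) =
      Module.finrank K S := by
  have h := (f.domRestrict S).finrank_range_add_finrank_ker
  rw [LinearMap.range_domRestrict, ← Submodule.finrank_map_subtype_eq S] at h
  have e : S ⊓ LinearMap.ker f = (LinearMap.ker (f.domRestrict S)).map S.subtype := by
    ext x
    simp [LinearMap.mem_ker, and_comm]
  rw [e, h]

/-- Rank-nullity for the complex given by multiplication by `v`. -/
theorem finrank_formHomology {M : Type*} [AddCommGroup M] [Module K M] [Module (Ext K n) M]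
    [IsScalarTower K (Ext K n) M] [FiniteDimensional K M] (gr : ℤ → Submodule K M)
    (v : Fin n → K) (j : ℤ) (h : (gr (j - 1)).map (mulForm M v) ≤ gr j) :
    Module.finrank K (formHomology gr v j) + Module.finrank K ((gr j).map (mulForm M v)) +
      Module.finrank K ((gr (j - 1)).map (mulForm M v)) = Module.finrank K (gr j) := by
  have hle : boundaries gr v j ≤ cycles gr v j := by
    refine le_inf h ?_
    rintro _ ⟨x, -, rfl⟩
    simp [mulForm, smul_smul]
  have h1 := ((boundaries gr v j).submoduleOf (cycles gr v j)).finrank_quotient_add_finrank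
  rw [(Submodule.submoduleOfEquivOfLe hle).finrank_eq] at h1
  have h2 := finrank_map_add_finrank_inf_ker (mulForm M v) (gr j)
  rw [cycles] at h1
  rw [boundaries] at h1
  change Module.finrank K (formHomology gr v j) + _ = _ at h1
  omega

instance : FiniteDimensional K (Ext K n) := Module.Finite.of_basis (monomialBasis K n)

/-- The annihilator numbers of `E/J` are determined by the Hilbert functions of the ideals
`J + (v_1, …, v_m)`. -/
theorem annihilatorNumberQuot_add {J : Ideal (Ext K n)} (hJ : J.IsHomogeneous (extGrading K n))
    (v : Fin n → Fin n → K) (i : Fin n) (j : ℤ) :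
    annihilatorNumberQuot J v i j +
        Module.finrank K (idealDeg (J ⊔ formsIdeal v (i.val + 1)) (j + 1)) +
        Module.finrank K (idealDeg (J ⊔ formsIdeal v (i.val + 1)) j) =
      Module.finrank K (extDeg K n j) +
        Module.finrank K (idealDeg (J ⊔ formsIdeal v i.val) (j + 1)) := by
  set N := initialSubmodule (Ext K n ⧸ J) v i with hN
  set A := J ⊔ formsIdeal v i.val with hA
  have hA' : J ⊔ formsIdeal v (i.val + 1) =
      A ⊔ Ideal.span {(ExteriorAlgebra.ι K (v i) : Ext K n)} := by
    rw [formsIdeal_succ, sup_assoc]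
  have hAh : A.IsHomogeneous (extGrading K n) := hJ.sup (formsIdeal_isHomogeneous v i.val)
  let q : Ext K n →ₗ[Ext K n] (Ext K n ⧸ J) ⧸ N := N.mkQ ∘ₗ J.mkQ
  have hq : ∀ x, q x = 0 ↔ x ∈ A := by
    intro x
    have hq1 : q x = 0 ↔ J.mkQ x ∈ N := by
      rw [LinearMap.comp_apply, Submodule.mkQ_apply, Submodule.Quotient.mk_eq_zero]
    rw [hq1]
    constructor
    · intro hx
      -- `N` is generated by all products of the forms with elements of `E/J`; these come from the left
      -- ideal generated by the forms because that ideal is two-sided.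
      have hle : N ≤ Submodule.map J.mkQ A := by
        rw [hN, initialSubmodule, Submodule.smul_le]
        intro r hr m _
        obtain ⟨y, rfl⟩ := J.mkQ_surjective m
        rw [← map_smul]
        exact ⟨_, Submodule.mem_sup_right (mul_mem_formsIdeal v i.val hr y), rfl⟩
      have : x ∈ (Submodule.map J.mkQ A).comap J.mkQ := hle hx
      rwa [Submodule.comap_map_mkQ, sup_eq_right.2 le_sup_left] at this
    · intro hx
      have hle : A ≤ N.comap J.mkQ := by
        refine sup_le (fun y hy => ?_) (fun y hy => ?_)
        · have : J.mkQ y = 0 := by simpa using hy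
          simp [this]
        · have e : J.mkQ y = y • J.mkQ 1 := by rw [← map_smul, smul_eq_mul, mul_one]
          rw [Submodule.mem_comap, e]
          exact Submodule.smul_mem_smul hy trivial
      exact hle hx
  let qK : Ext K n →ₗ[K] (Ext K n ⧸ J) ⧸ N := q.restrictScalars K
  have hker : LinearMap.ker qK = A.restrictScalars K := by
    ext x
    exact hq x
  have hgr : ∀ j, quotGrading (quotGrading (extDeg K n) J) N j = (extDeg K n j).map qK := by
    intro j
    rw [quotGrading, quotGrading, ← Submodule.map_comp]
    rfl
  have hμ : ∀ x, mulForm ((Ext K n ⧸ J) ⧸ N) (v i) (qK x) =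
      qK (ExteriorAlgebra.ι K (v i) * x) := by
    intro x
    exact (map_smul q (ExteriorAlgebra.ι K (v i)) x).symm
  have : FiniteDimensional K ((Ext K n ⧸ J) ⧸ N) := by
    refine Module.Finite.of_surjective qK ?_
    exact (N.mkQ_surjective).comp J.mkQ_surjective
  have hrank : ∀ j, Module.finrank K (((extDeg K n j).map qK).map
        (mulForm ((Ext K n ⧸ J) ⧸ N) (v i))) + Module.finrank K (idealDeg A (j + 1)) =
      Module.finrank K (idealDeg (J ⊔ formsIdeal v (i.val + 1)) (j + 1)) := by
    intro j
    have e1 : ((extDeg K n j).map qK).map (mulForm ((Ext K n ⧸ J) ⧸ N) (v i)) =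
        (idealDeg (J ⊔ formsIdeal v (i.val + 1)) (j + 1)).map qK := by
      apply le_antisymm
      · rintro _ ⟨_, ⟨x, hx, rfl⟩, rfl⟩
        rw [hμ]
        refine ⟨_, ⟨?_, ι_mul_mem_extDeg (v i) hx⟩, rfl⟩
        rw [hA', SetLike.mem_coe, Submodule.restrictScalars_mem, ι_mul_eq]
        exact Submodule.mem_sup_right (Ideal.mul_mem_left _ _ (Ideal.subset_span rfl))
      · rintro _ ⟨f, ⟨hf, hfj⟩, rfl⟩
        rw [hA'] at hf
        obtain ⟨x, hx, hfx⟩ := exists_sub_ι_mul_mem hAh (v i) hf hfj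
        refine ⟨qK x, ⟨x, hx, rfl⟩, ?_⟩
        rw [hμ]
        have h0 : qK (f - ExteriorAlgebra.ι K (v i) * x) = 0 := (hq _).2 hfx
        rw [map_sub, sub_eq_zero] at h0
        exact h0.symm
    have e2 : idealDeg A (j + 1) =
        idealDeg (J ⊔ formsIdeal v (i.val + 1)) (j + 1) ⊓ A.restrictScalars K := by
      rw [hA']
      refine le_antisymm (fun x hx => ⟨⟨Submodule.mem_sup_left hx.1, hx.2⟩, hx.1⟩)
        fun x hx => ⟨hx.2, hx.1.2⟩
    rw [← finrank_map_add_finrank_inf_ker qK (idealDeg (J ⊔ formsIdeal v (i.val + 1)) (j + 1)),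
      hker, e1, e2]
  have hdim := finrank_map_add_finrank_inf_ker qK (extDeg K n j)
  rw [hker, inf_comm] at hdim
  change _ + Module.finrank K (idealDeg A j) = _ at hdim
  have hle : ((quotGrading (quotGrading (extDeg K n) J) N (j - 1)).map
      (mulForm ((Ext K n ⧸ J) ⧸ N) (v i))) ≤ quotGrading (quotGrading (extDeg K n) J) N j := by
    rw [hgr, hgr]
    rintro _ ⟨_, ⟨x, hx, rfl⟩, rfl⟩
    rw [hμ]
    have := ι_mul_mem_extDeg (v i) hx
    rw [sub_add_cancel] at this
    exact ⟨_, this, rfl⟩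
  have hH := finrank_formHomology _ (v i) j hle
  rw [hgr, hgr] at hH
  change annihilatorNumberQuot J v i j + _ + _ = _ at hH
  have h1 := hrank j
  have h2 := hrank (j - 1)
  rw [sub_add_cancel] at h2
  omega

theorem annihilatorNumberQuot_congr {J J' : Ideal (Ext K n)}
    (hJ : J.IsHomogeneous (extGrading K n)) (hJ' : J'.IsHomogeneous (extGrading K n))
    {v v' : Fin n → Fin n → K}
    (h : ∀ m j, Module.finrank K (idealDeg (J ⊔ formsIdeal v m) j) =
      Module.finrank K (idealDeg (J' ⊔ formsIdeal v' m) j)) (i : Fin n) (j : ℤ) :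
    annihilatorNumberQuot J v i j = annihilatorNumberQuot J' v' i j := by
  have h1 := annihilatorNumberQuot_add hJ v i j
  have h2 := annihilatorNumberQuot_add hJ' v' i j
  simp only [h] at h1
  omega

end HilbertFunctions

/-! ### The action of the general linear group -/

section Automorphisms

variable {K : Type*} [Field K] {n : ℕ}

theorem map_inv_map (g : GL (Fin n) K) (x : Ext K n) :
    ExteriorAlgebra.map (Matrix.toLin' g⁻¹.1) (ExteriorAlgebra.map (Matrix.toLin' g.1) x) = x := by
  rw [← AlgHom.comp_apply, ExteriorAlgebra.map_comp_map, ← Matrix.toLin'_mul, Units.inv_mul,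
    Matrix.toLin'_one, ExteriorAlgebra.map_id, AlgHom.id_apply]

theorem map_map_inv (g : GL (Fin n) K) (x : Ext K n) :
    ExteriorAlgebra.map (Matrix.toLin' g.1) (ExteriorAlgebra.map (Matrix.toLin' g⁻¹.1) x) = x := by
  simpa using map_inv_map g⁻¹ x

theorem mem_actIdeal {g : GL (Fin n) K} {J : Ideal (Ext K n)} {x : Ext K n} :
    x ∈ actIdeal g J ↔ ExteriorAlgebra.map (Matrix.toLin' g⁻¹.1) x ∈ J := by
  constructor
  · have h : actIdeal g J ≤ J.comap (ExteriorAlgebra.map (Matrix.toLin' g⁻¹.1)) := by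
      rw [actIdeal, Ideal.map_le_iff_le_comap]
      intro y hy
      rwa [Ideal.mem_comap, Ideal.mem_comap, map_inv_map]
    exact fun hx => h hx
  · intro hx
    rw [← map_map_inv g x]
    exact Ideal.mem_map_of_mem _ hx

theorem decompose_map (f : (Fin n → K) →ₗ[K] Fin n → K) (x : Ext K n) (j : ℕ) :
    (DirectSum.decompose (extGrading K n) (ExteriorAlgebra.map f x) j : Ext K n) =
      ExteriorAlgebra.map f (DirectSum.decompose (extGrading K n) x j : Ext K n) := by
  induction x using DirectSum.Decomposition.inductionOn (extGrading K n) with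
  | zero => simp
  | @homogeneous i y =>
    have h := map_mem_extGrading f y.2
    by_cases e : i = j
    · subst e
      rw [DirectSum.decompose_of_mem_same _ h, DirectSum.decompose_of_mem_same _ y.2]
    · rw [DirectSum.decompose_of_mem_ne _ h e, DirectSum.decompose_of_mem_ne _ y.2 e, map_zero]
  | add a b ha hb => simp [ha, hb]

theorem actIdeal_isHomogeneous (g : GL (Fin n) K) {J : Ideal (Ext K n)}
    (hJ : J.IsHomogeneous (extGrading K n)) :
    (actIdeal g J).IsHomogeneous (extGrading K n) := by
  intro j x hx
  rw [mem_actIdeal] at hx ⊢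
  rw [← decompose_map]
  exact hJ j hx

theorem actIdeal_restrictScalars (g : GL (Fin n) K) (J : Ideal (Ext K n)) :
    (actIdeal g J).restrictScalars K =
      (J.restrictScalars K).map (ExteriorAlgebra.map (Matrix.toLin' g.1)).toLinearMap := by
  ext x
  rw [Submodule.restrictScalars_mem, mem_actIdeal]
  constructor
  · exact fun h => ⟨_, h, map_map_inv g x⟩
  · rintro ⟨y, hy, rfl⟩
    rw [AlgHom.toLinearMap_apply, map_inv_map]
    exact hy

theorem finrank_map_exteriorMap (g : GL (Fin n) K) (S : Submodule K (Ext K n)) :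
    Module.finrank K (S.map (ExteriorAlgebra.map (Matrix.toLin' g.1)).toLinearMap) =
      Module.finrank K S :=
  (Submodule.equivMapOfInjective (ExteriorAlgebra.map (Matrix.toLin' g.1)).toLinearMap
    (Function.LeftInverse.injective
      (g := ExteriorAlgebra.map (Matrix.toLin' g⁻¹.1)) (map_inv_map g)) S).finrank_eq.symm

theorem finrank_idealDeg_actIdeal (g : GL (Fin n) K) (J : Ideal (Ext K n)) (j : ℤ) :
    Module.finrank K (idealDeg (actIdeal g J) j) = Module.finrank K (idealDeg J j) := by
  rw [← finrank_map_exteriorMap g (idealDeg J j)]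
  have e : idealDeg (actIdeal g J) j =
      (idealDeg J j).map (ExteriorAlgebra.map (Matrix.toLin' g.1)).toLinearMap := by
    ext x
    constructor
    · rintro ⟨h, hj⟩
      exact ⟨_, ⟨mem_actIdeal.1 h, map_mem_extDeg _ hj⟩, map_map_inv g x⟩
    · rintro ⟨y, ⟨hy, hj⟩, rfl⟩
      exact ⟨Ideal.mem_map_of_mem _ hy, map_mem_extDeg _ hj⟩
  rw [e]

theorem actIdeal_formsIdeal (g : GL (Fin n) K) (v : Fin n → Fin n → K) (m : ℕ) :
    actIdeal g (formsIdeal v m) = formsIdeal (fun l => actForm g (v l)) m := by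
  rw [actIdeal, formsIdeal, formsIdeal, Ideal.map_span]
  congr 1
  ext x
  constructor
  · rintro ⟨_, ⟨l, hl, rfl⟩, rfl⟩
    exact ⟨l, hl, by simp [actForm]⟩
  · rintro ⟨l, hl, rfl⟩
    exact ⟨_, ⟨l, hl, rfl⟩, by simp [actForm]⟩

theorem annihilatorNumberQuot_actIdeal (g : GL (Fin n) K) {J : Ideal (Ext K n)}
    (hJ : J.IsHomogeneous (extGrading K n)) (v : Fin n → Fin n → K) (i : Fin n) (j : ℤ) :
    annihilatorNumberQuot (actIdeal g J) (fun l => actForm g (v l)) i j =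
      annihilatorNumberQuot J v i j := by
  refine annihilatorNumberQuot_congr (actIdeal_isHomogeneous g hJ) hJ (fun m j => ?_) i j
  rw [← actIdeal_formsIdeal, ← finrank_idealDeg_actIdeal g (J ⊔ _)]
  have e : actIdeal g (J ⊔ formsIdeal v m) = actIdeal g J ⊔ actIdeal g (formsIdeal v m) :=
    Ideal.map_sup (ExteriorAlgebra.map (Matrix.toLin' g.1)) J (formsIdeal v m)
  rw [e]

theorem annihilatorNumberQuot_initialIdeal {J : Ideal (Ext K n)}
    (hJ : J.IsHomogeneous (extGrading K n)) (i : Fin n) (j : ℤ) :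
    annihilatorNumberQuot (initialIdeal J) (stdVec K n) i j =
      annihilatorNumberQuot J (stdVec K n) i j :=
  annihilatorNumberQuot_congr (initialIdeal_isHomogeneous J) hJ
    (finrank_idealDeg_initialIdeal hJ) i j

end Automorphisms

/-! ### Zariski-open sets and generic initial ideals -/

section Zariski

variable {K : Type*} [Field K] {n : ℕ}

theorem IsZariskiOpen.univ : IsZariskiOpen (Set.univ : Set (GL (Fin n) K)) :=
  ⟨{1}, by ext; simp⟩

theorem IsZariskiOpen.inter {U U' : Set (GL (Fin n) K)} (h : IsZariskiOpen U)
    (h' : IsZariskiOpen U') : IsZariskiOpen (U ∩ U') := by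
  obtain ⟨S, rfl⟩ := h
  obtain ⟨S', rfl⟩ := h'
  refine ⟨{p | ∃ q ∈ S, ∃ q' ∈ S', p = q * q'}, ?_⟩
  ext g
  constructor
  · rintro ⟨⟨p, hp, h⟩, ⟨p', hp', h'⟩⟩
    exact ⟨p * p', ⟨p, hp, p', hp', rfl⟩, by rw [map_mul]; exact mul_ne_zero h h'⟩
  · rintro ⟨_, ⟨p, hp, p', hp', rfl⟩, h⟩
    rw [map_mul] at h
    exact ⟨⟨p, hp, left_ne_zero_of_mul h⟩, ⟨p', hp', right_ne_zero_of_mul h⟩⟩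

theorem eval_det_mvPolynomialX (x : Fin n × Fin n → K) :
    MvPolynomial.eval x (Matrix.mvPolynomialX (Fin n) (Fin n) K).det =
      (Matrix.of fun a b => x (a, b)).det := by
  rw [RingHom.map_det]
  congr 1
  ext a b
  simp [Matrix.mvPolynomialX]

/-- Over an infinite field `GL_n` is irreducible. -/
theorem IsZariskiOpen.inter_nonempty [Infinite K] {U U' : Set (GL (Fin n) K)}
    (h : IsZariskiOpen U) (h' : IsZariskiOpen U') (hU : U.Nonempty) (hU' : U'.Nonempty) :
    (U ∩ U').Nonempty := by
  obtain ⟨S, rfl⟩ := h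
  obtain ⟨S', rfl⟩ := h'
  obtain ⟨g, p, hp, hg⟩ := hU
  obtain ⟨g', p', hp', hg'⟩ := hU'
  have hne : p * p' * (Matrix.mvPolynomialX (Fin n) (Fin n) K).det ≠ 0 := by
    refine mul_ne_zero (mul_ne_zero ?_ ?_) (Matrix.det_mvPolynomialX_ne_zero _ _)
    · rintro rfl; simp at hg
    · rintro rfl; simp at hg'
  obtain ⟨x, hx⟩ : ∃ x, MvPolynomial.eval x
      (p * p' * (Matrix.mvPolynomialX (Fin n) (Fin n) K).det) ≠ 0 := by
    by_contra! hx
    exact hne (MvPolynomial.funext fun x => by rw [hx, map_zero])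
  rw [map_mul, map_mul, eval_det_mvPolynomialX] at hx
  refine ⟨Matrix.GeneralLinearGroup.mkOfDetNeZero _ (right_ne_zero_of_mul hx), ⟨p, hp, ?_⟩,
    ⟨p', hp', ?_⟩⟩
  · exact left_ne_zero_of_mul (left_ne_zero_of_mul hx)
  · exact right_ne_zero_of_mul (left_ne_zero_of_mul hx)

theorem IsZariskiOpen.iInter [Infinite K] {α : Type*} [Finite α] {U : α → Set (GL (Fin n) K)}
    (h : ∀ a, IsZariskiOpen (U a)) (hU : ∀ a, (U a).Nonempty) :
    IsZariskiOpen (⋂ a, U a) ∧ (⋂ a, U a).Nonempty := by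
  classical
  cases nonempty_fintype α
  have key : ∀ s : Finset α, IsZariskiOpen (⋂ a ∈ s, U a) ∧ (⋂ a ∈ s, U a).Nonempty := by
    intro s
    induction s using Finset.induction_on with
    | empty =>
      rw [show (⋂ a ∈ (∅ : Finset α), U a) = Set.univ by simp]
      exact ⟨IsZariskiOpen.univ, Set.univ_nonempty⟩
    | insert a s _ ih =>
      rw [Finset.set_biInter_insert]
      exact ⟨(h a).inter ih.1, (h a).inter_nonempty ih.1 (hU a) ih.2⟩
  simpa using key Finset.univ

theorem IsZariskiOpen.preimage_mul_right {U : Set (GL (Fin n) K)} (h : IsZariskiOpen U)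
    (P : GL (Fin n) K) : IsZariskiOpen {g | g * P ∈ U} := by
  obtain ⟨S, rfl⟩ := h
  refine ⟨(fun p => MvPolynomial.bind₁ (fun q : Fin n × Fin n =>
    ∑ l, MvPolynomial.X (q.1, l) * MvPolynomial.C (P.1 l q.2)) p) '' S, ?_⟩
  ext g
  simp only [Set.mem_ofPred_eq, Set.exists_mem_image]
  refine exists_congr fun p => and_congr_right fun _ => ?_
  have e : (fun q : Fin n × Fin n => (g * P).1 q.1 q.2) = fun q : Fin n × Fin n =>
      MvPolynomial.eval₂Hom (RingHom.id K) (fun q : Fin n × Fin n => g.1 q.1 q.2)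
        (∑ l, MvPolynomial.X (q.1, l) * MvPolynomial.C (P.1 l q.2)) := by
    funext q
    simp [Matrix.mul_apply]
  have h := MvPolynomial.eval₂Hom_bind₁ (RingHom.id K) (fun q : Fin n × Fin n => g.1 q.1 q.2)
    (fun q => ∑ l, MvPolynomial.X (q.1, l) * MvPolynomial.C (P.1 l q.2)) p
  rw [← e] at h
  exact not_congr (Eq.congr_left h.symm)

/-- A polynomial in the entries of `g⁻¹` becomes a polynomial in the entries of `g` after
multiplication by a power of `det g`. -/
theorem exists_eval_inv (p : MvPolynomial (Fin n × Fin n) K) :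
    ∃ (N : ℕ) (q : MvPolynomial (Fin n × Fin n) K), ∀ g : GL (Fin n) K,
      MvPolynomial.eval (fun x : Fin n × Fin n => g.1 x.1 x.2) q =
        g.1.det ^ N * MvPolynomial.eval (fun x : Fin n × Fin n => g⁻¹.1 x.1 x.2) p := by
  have hdet : ∀ g : GL (Fin n) K, MvPolynomial.eval (fun x : Fin n × Fin n => g.1 x.1 x.2)
      (Matrix.mvPolynomialX (Fin n) (Fin n) K).det = g.1.det := fun g => by
    rw [eval_det_mvPolynomialX]
    rfl
  induction p using MvPolynomial.induction_on with
  | C c => exact ⟨0, MvPolynomial.C c, fun g => by simp⟩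
  | add p p' hp hp' =>
    obtain ⟨N, q, hq⟩ := hp
    obtain ⟨N', q', hq'⟩ := hp'
    refine ⟨N + N', (Matrix.mvPolynomialX (Fin n) (Fin n) K).det ^ N' * q +
      (Matrix.mvPolynomialX (Fin n) (Fin n) K).det ^ N * q', fun g => ?_⟩
    simp only [map_add, map_mul, map_pow, hdet, hq, hq']
    ring
  | mul_X p x hp =>
    obtain ⟨N, q, hq⟩ := hp
    -- Each entry of `g⁻¹` costs one factor `det g`, by Cramer's rule.
    refine ⟨N + 1, q * (Matrix.mvPolynomialX (Fin n) (Fin n) K).adjugate x.1 x.2, fun g => ?_⟩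
    have h : MvPolynomial.eval (fun x : Fin n × Fin n => g.1 x.1 x.2)
        ((Matrix.mvPolynomialX (Fin n) (Fin n) K).adjugate x.1 x.2) =
          g.1.adjugate x.1 x.2 := by
      have := RingHom.map_adjugate (MvPolynomial.eval (fun x : Fin n × Fin n => g.1 x.1 x.2))
        (Matrix.mvPolynomialX (Fin n) (Fin n) K)
      have e : (MvPolynomial.eval (fun x : Fin n × Fin n => g.1 x.1 x.2)).mapMatrix
          (Matrix.mvPolynomialX (Fin n) (Fin n) K) = g.1 := by
        ext a b
        simp [Matrix.mvPolynomialX]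
      rw [e] at this
      rw [← this]
      rfl
    have h' : g.1.adjugate x.1 x.2 = g.1.det * g⁻¹.1 x.1 x.2 := by
      have hu : g.1.det ≠ 0 := ((Matrix.isUnit_iff_isUnit_det _).1 g.isUnit).ne_zero
      rw [Matrix.coe_units_inv, Matrix.inv_def, Matrix.smul_apply, smul_eq_mul, ← mul_assoc,
        Ring.mul_inverse_cancel _ (isUnit_iff_ne_zero.2 hu), one_mul]
    simp only [map_mul, hq, h, h', MvPolynomial.eval_X]
    ring

theorem IsZariskiOpen.preimage_inv {U : Set (GL (Fin n) K)} (h : IsZariskiOpen U) :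
    IsZariskiOpen {g | g⁻¹ ∈ U} := by
  obtain ⟨S, rfl⟩ := h
  choose N q hq using exists_eval_inv (K := K) (n := n)
  refine ⟨q '' S, ?_⟩
  ext g
  simp only [Set.mem_ofPred_eq, Set.exists_mem_image]
  refine exists_congr fun p => and_congr_right fun _ => ?_
  have hu : g.1.det ≠ 0 := ((Matrix.isUnit_iff_isUnit_det _).1 g.isUnit).ne_zero
  rw [hq, mul_ne_zero_iff]
  exact ⟨fun h => ⟨pow_ne_zero _ hu, h⟩, fun h => h.2⟩

/-- Finitely many bounded lower semicontinuous functions are simultaneously constant (with their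
maximal values) on a nonempty Zariski-open set. -/
theorem exists_isZariskiOpen_const [Infinite K] {α : Type*} [Finite α]
    (r : α → GL (Fin n) K → ℕ) (B : ℕ) (hB : ∀ a g, r a g ≤ B)
    (hr : ∀ a m, IsZariskiOpen {g | m ≤ r a g}) :
    ∃ U : Set (GL (Fin n) K), IsZariskiOpen U ∧ U.Nonempty ∧
      ∀ g ∈ U, ∀ g' ∈ U, ∀ a, r a g = r a g' := by
  have hmax : ∀ a, ∃ g₀, ∀ g, r a g ≤ r a g₀ := by
    intro a
    have hbdd : BddAbove (Set.range (r a)) := ⟨B, by rintro _ ⟨g, rfl⟩; exact hB a g⟩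
    obtain ⟨g₀, hg₀⟩ := Nat.sSup_mem (Set.range_nonempty (r a)) hbdd
    exact ⟨g₀, fun g => hg₀ ▸ le_csSup hbdd ⟨g, rfl⟩⟩
  choose g₀ hg₀ using hmax
  obtain ⟨h1, h2⟩ := IsZariskiOpen.iInter (U := fun a => {g | r a (g₀ a) ≤ r a g})
    (fun a => hr a _) (fun a => ⟨g₀ a, le_refl (r a (g₀ a))⟩)
  refine ⟨_, h1, h2, fun g hg g' hg' a => ?_⟩
  rw [Set.mem_iInter] at hg hg'
  exact (le_antisymm (hg₀ a g) (hg a)).trans (le_antisymm (hg₀ a g') (hg' a)).symm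

/-- The coordinates of `g(x)` are polynomials in the entries of `g`. -/
theorem exists_eval_eq_map (x : Ext K n) (ℓ : Ext K n →ₗ[K] K) :
    ∃ p : MvPolynomial (Fin n × Fin n) K, ∀ g : GL (Fin n) K,
      ℓ (ExteriorAlgebra.map (Matrix.toLin' g.1) x) =
        MvPolynomial.eval (fun q : Fin n × Fin n => g.1 q.1 q.2) p := by
  induction x using ExteriorAlgebra.induction generalizing ℓ with
  | algebraMap c => exact ⟨MvPolynomial.C (ℓ (algebraMap K _ c)), fun g => by simp⟩
  | ι v =>
    refine ⟨∑ a, ∑ b, MvPolynomial.X (a, b) * MvPolynomial.C (v b) *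
      MvPolynomial.C (ℓ (ExteriorAlgebra.ι K (stdVec K n a))), fun g => ?_⟩
    rw [ExteriorAlgebra.map_apply_ι, ι_eq_sum]
    simp [Matrix.toLin'_apply, Matrix.mulVec, dotProduct, Finset.sum_mul]
  | mul x y hx hy =>
    choose px hpx using fun F => hx ((monomialBasis K n).coord F)
    choose py hpy using fun F => hy ((monomialBasis K n).coord F)
    refine ⟨∑ F, ∑ G, px F * py G *
      MvPolynomial.C (ℓ (monomialBasis K n F * monomialBasis K n G)), fun g => ?_⟩
    rw [map_mul, ← (monomialBasis K n).sum_repr (ExteriorAlgebra.map (Matrix.toLin' g.1) x),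
      ← (monomialBasis K n).sum_repr (ExteriorAlgebra.map (Matrix.toLin' g.1) y)]
    simp only [Finset.sum_mul_sum, smul_mul_smul_comm, map_sum, map_smul, map_mul, smul_eq_mul,
      ← hpx, ← hpy, MvPolynomial.eval_C, Module.Basis.coord_apply]
  | add x y hx hy =>
    obtain ⟨p, hp⟩ := hx ℓ
    obtain ⟨q, hq⟩ := hy ℓ
    exact ⟨p + q, fun g => by rw [map_add, map_add, hp, hq, map_add]⟩

/-- A rank is at least `m` if and only if some `m × m` minor, for freely chosen vectors and linear
forms, does not vanish. -/
theorem le_finrank_map_iff {V Q : Type*} [AddCommGroup V] [Module K V] [AddCommGroup Q]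
    [Module K Q] [FiniteDimensional K Q] (f : V →ₗ[K] Q) (W : Submodule K V) (m : ℕ) :
    m ≤ Module.finrank K (W.map f) ↔ ∃ (x : Fin m → W) (ℓ : Fin m → Q →ₗ[K] K),
      (Matrix.of fun a b => ℓ a (f (x b))).det ≠ 0 := by
  constructor
  · intro h
    obtain ⟨y, hy⟩ := exists_linearIndependent_of_le_finrank h
    have hy' : LinearIndependent K fun b => (y b : Q) := hy.map' (W.map f).subtype (by simp)
    choose x hx hxy using fun b => (y b).2
    obtain ⟨s, hs⟩ := (Fintype.linearCombination K fun b => (y b : Q)).exists_leftInverse_of_injective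
      (LinearMap.ker_eq_bot.2 hy'.fintypeLinearCombination_injective)
    refine ⟨fun b => ⟨x b, hx b⟩, fun a => LinearMap.proj a ∘ₗ s, ?_⟩
    have e : (Matrix.of fun a b => (LinearMap.proj a ∘ₗ s) (f (x b))) =
        (1 : Matrix (Fin m) (Fin m) K) := by
      ext a b
      have := LinearMap.congr_fun hs (Pi.single b 1)
      simp only [LinearMap.comp_apply, Fintype.linearCombination_apply_single, one_smul,
        LinearMap.id_apply] at this
      simp [hxy, this, Matrix.one_apply, Pi.single_apply]
    rw [e, Matrix.det_one]
    exact one_ne_zero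
  · rintro ⟨x, ℓ, h⟩
    have h1 : LinearIndependent K (Matrix.of fun a b => ℓ a (f (x b))).col :=
      Matrix.linearIndependent_cols_iff_isUnit.2
        ((Matrix.isUnit_iff_isUnit_det _).2 (isUnit_iff_ne_zero.2 h))
    have h2 : LinearIndependent K
        fun b => (⟨f (x b), ⟨_, (x b).2, rfl⟩⟩ : W.map f) := by
      refine LinearIndependent.of_comp ((LinearMap.pi ℓ).comp (W.map f).subtype) ?_
      exact h1
    simpa using h2.fintype_card_le_finrank

theorem isZariskiOpen_le_finrank {Q : Type*} [AddCommGroup Q] [Module K Q]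
    [FiniteDimensional K Q] (f : Ext K n →ₗ[K] Q) (W : Submodule K (Ext K n)) (m : ℕ) :
    IsZariskiOpen {g : GL (Fin n) K | m ≤ Module.finrank K
      (W.map (f ∘ₗ (ExteriorAlgebra.map (Matrix.toLin' g.1)).toLinearMap))} := by
  choose p hp using exists_eval_eq_map (K := K) (n := n)
  refine ⟨{d | ∃ (x : Fin m → W) (ℓ : Fin m → Q →ₗ[K] K),
    d = (Matrix.of fun a b => p (x b) (ℓ a ∘ₗ f)).det}, ?_⟩
  have key : ∀ (g : GL (Fin n) K) (x : Fin m → W) (ℓ : Fin m → Q →ₗ[K] K),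
      MvPolynomial.eval (fun q : Fin n × Fin n => g.1 q.1 q.2)
        (Matrix.of fun a b => p (x b) (ℓ a ∘ₗ f)).det =
      (Matrix.of fun a b => ℓ a ((f ∘ₗ
        (ExteriorAlgebra.map (Matrix.toLin' g.1)).toLinearMap) (x b))).det := by
    intro g x ℓ
    rw [RingHom.map_det]
    congr 1
    ext a b
    exact (hp _ _ g).symm
  ext g
  rw [Set.mem_ofPred_eq, Set.mem_ofPred_eq, le_finrank_map_iff]
  constructor
  · rintro ⟨x, ℓ, h⟩
    exact ⟨_, ⟨x, ℓ, rfl⟩, by rwa [key]⟩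
  · rintro ⟨_, ⟨x, ℓ, rfl⟩, h⟩
    exact ⟨x, ℓ, by rwa [key] at h⟩

/-- The dimensions of the intersections of `g(J)` with the subspaces spanned by monomials are the
same for all generic `g`, and they determine the initial ideal. -/
theorem exists_isGenericInitialIdeal [Infinite K] (J : Ideal (Ext K n)) :
    ∃ I, IsGenericInitialIdeal J I := by
  let sp : Set (Finset (Fin n)) → Submodule K (Ext K n) := fun D =>
    Submodule.span K (monomialBasis K n '' D)
  let φ : GL (Fin n) K → Ext K n →ₗ[K] Ext K n := fun g =>
    (ExteriorAlgebra.map (Matrix.toLin' g.1)).toLinearMap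
  let r : Set (Finset (Fin n)) → GL (Fin n) K → ℕ := fun D g =>
    Module.finrank K ((J.restrictScalars K).map ((sp D).mkQ ∘ₗ φ g))
  obtain ⟨U, hU, ⟨g₀, hg₀⟩, hconst⟩ := exists_isZariskiOpen_const r (Module.finrank K (Ext K n))
    (fun D g => (Submodule.finrank_map_le _ _).trans (Submodule.finrank_le _))
    (fun D m => isZariskiOpen_le_finrank _ _ m)
  refine ⟨initialIdeal (actIdeal g₀ J), U, hU, ⟨g₀, hg₀⟩, fun g hg => ?_⟩
  have hdim : ∀ g D, r D g + Module.finrank K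
      (supportedIn (monomialBasis K n) ((actIdeal g J).restrictScalars K) D) =
        Module.finrank K (J.restrictScalars K) := by
    intro g D
    have h := finrank_map_add_finrank_inf_ker (sp D).mkQ ((J.restrictScalars K).map (φ g))
    rw [← Submodule.map_comp, Submodule.ker_mkQ, finrank_map_exteriorMap g] at h
    rw [actIdeal_restrictScalars]
    exact h
  rw [initialIdeal_eq_span, initialIdeal_eq_span]
  congr 2
  refine leadSet_eq_of_finrank_eq _ _ fun D => ?_
  have h1 := hdim g D
  have h2 := hdim g₀ D
  rw [hconst g hg g₀ hg₀ D] at h1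
  omega

theorem isGenericInitialIdeal_gin [Infinite K] (J : Ideal (Ext K n)) :
    IsGenericInitialIdeal J (gin J) := by
  have h := exists_isGenericInitialIdeal J
  rw [gin, dif_pos h]
  exact h.choose_spec

end Zariski

section Generic

variable {K : Type*} [Field K] {n : ℕ}

variable (K) in
/-- The element of `GL_n(K)` that permutes the variables by `σ`. -/
def permGL (σ : Equiv.Perm (Fin n)) : GL (Fin n) K :=
  Matrix.GeneralLinearGroup.mkOfDetNeZero ((σ⁻¹).permMatrix K) (by
    rw [Matrix.det_permutation]
    rcases Int.units_eq_one_or (Equiv.Perm.sign σ⁻¹) with h | h <;> simp [h])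

theorem actForm_permGL (σ : Equiv.Perm (Fin n)) (l : Fin n) :
    actForm (permGL K σ) (stdVec K n l) = stdVec K n (σ l) := by
  ext i
  simp [actForm, permGL, stdVec, Matrix.GeneralLinearGroup.mkOfDetNeZero,
    Equiv.Perm.permMatrix, PEquiv.toMatrix_apply, Pi.single_apply, Equiv.symm_apply_eq]

theorem actForm_mul (g h : GL (Fin n) K) (v : Fin n → K) :
    actForm (g * h) v = actForm g (actForm h v) := by
  simp [actForm]

theorem infinite_of_algebraicIndependent {k : Type*} [Field k] [Algebra k K] [NeZero n]
    {a : Fin n × Fin n → K} (ha : AlgebraicIndependent k a) : Infinite K := by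
  by_contra hfin
  rw [not_infinite_iff_finite] at hfin
  exact ha.transcendental (0, 0) (Algebra.IsAlgebraic.isAlgebraic _)

end Generic

end ExteriorAnnihilator

end

open ExteriorAnnihilator in
theorem theorem4p5 {k K : Type*} [Field k] [Field K] [Algebra k K] {n : ℕ}
    (hK : ∃ a : Fin n × Fin n → K, AlgebraicIndependent k a)
    (J : Ideal (Ext K n)) (hJ : J.IsHomogeneous (extGrading K n)) :
    ∃ V : Set (GL (Fin n) K), IsZariskiOpen V ∧ V.Nonempty ∧
      ∀ γ ∈ V, ∀ σ : Equiv.Perm (Fin n), ∀ (i : Fin n) (j : ℤ),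
        genericAnnihilatorNumber J i j =
          annihilatorNumberQuot J (fun l => actForm γ (stdVec K n (σ l))) i j := by
  -- For `n = 0` the field may be finite, but there is no index `i`.
  rcases Nat.eq_zero_or_pos n with rfl | hn
  · exact ⟨Set.univ, IsZariskiOpen.univ, Set.univ_nonempty, fun _ _ _ i => i.elim0⟩
  have : NeZero n := ⟨hn.ne'⟩
  obtain ⟨a, ha⟩ := hK
  have : Infinite K := infinite_of_algebraicIndependent ha
  obtain ⟨U, hU, ⟨g₀, hg₀⟩, hgin⟩ := isGenericInitialIdeal_gin J
  obtain ⟨hV, hVne⟩ := IsZariskiOpen.iInter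
    (U := fun σ : Equiv.Perm (Fin n) => {γ | (γ * permGL K σ)⁻¹ ∈ U})
    (fun σ => hU.preimage_inv.preimage_mul_right (permGL K σ))
    (fun σ => ⟨g₀⁻¹ * (permGL K σ)⁻¹, by simpa using hg₀⟩)
  refine ⟨_, hV, hVne, fun γ hγ σ i j => ?_⟩
  have hmem : (γ * permGL K σ)⁻¹ ∈ U := Set.mem_iInter.1 hγ σ
  rw [genericAnnihilatorNumber, ← hgin _ hmem,
    annihilatorNumberQuot_initialIdeal (actIdeal_isHomogeneous _ hJ),
    ← annihilatorNumberQuot_actIdeal (γ * permGL K σ)⁻¹ hJ]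
  congr 1
  funext l
  rw [← actForm_permGL, ← actForm_mul, ← actForm_mul, mul_assoc, inv_mul_cancel]
  simp [actForm]
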